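/- For every integer $d\ge 1$, there exists a finite bipartite graph of average degree at least $d$ that does not contain (as a not necessarily induced subgraph, up to isomorphism) the $1$-subdivision of any graph with Hall ratio greater than $18$. All graphs are finite and simple. The $1$-subdivision of a graph is obtained by subdividing each edge exactly once, and the Hall ratio of a graph $H$ is the maximum of $|V(K)|/\alpha(K)$ over all non-empty subgraphs $K$ of $H$, where $\alpha(K)$ is the maximum size of an independent set of $K$. -/

import Mathlib

namespace SimpleGraph

/-- The average degree of a finite graph: the mean of the degrees of its vertices. -/
noncomputable def averageDegree {V : Type*} [Fintype V] (G : SimpleGraph V)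
    [DecidableRel G.Adj] : ℝ :=
  (∑ v : V, (G.degree v : ℝ)) / (Fintype.card V : ℝ)

/-- Adjacency in the `1`-subdivision of `G`: the branch vertices are the vertices of `G`, the
subdivision vertices are the edges of `G`, and a branch vertex `v` is joined to a subdivision
vertex `e` exactly when `v` is an end of `e`. -/
def OneSubdivisionAdj {V : Type*} (G : SimpleGraph V) :
    V ⊕ G.edgeSet → V ⊕ G.edgeSet → Prop
  | Sum.inl v, Sum.inr e => v ∈ (e : Sym2 V)
  | Sum.inr e, Sum.inl v => v ∈ (e : Sym2 V)
  | Sum.inl _, Sum.inl _ => False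
  | Sum.inr _, Sum.inr _ => False

/-- The `1`-subdivision (incidence graph) of `G`. -/
def oneSubdivision {V : Type*} (G : SimpleGraph V) : SimpleGraph (V ⊕ G.edgeSet) where
  Adj := G.OneSubdivisionAdj
  symm := ⟨by rintro (v | e) (w | f) h <;> exact h⟩
  loopless := ⟨by rintro (v | e) h <;> exact h⟩

/-- The Hall ratio of a finite graph `G`: the maximum of `|V(K)| / α(K)` over all subgraphs `K`
of `G`. The empty subgraph contributes the value `0`. -/
noncomputable def hallRatio {V : Type*} [Finite V] (G : SimpleGraph V) : ℝ :=
  ⨆ K : G.Subgraph, (Nat.card K.verts : ℝ) / (K.coe.indepNum : ℝ)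

/-- The supremum in the definition of the Hall ratio is a maximum. -/
theorem hallRatio_isGreatest {V : Type*} [Finite V] (G : SimpleGraph V) :
    IsGreatest (Set.range fun K : G.Subgraph =>
      (Nat.card K.verts : ℝ) / (K.coe.indepNum : ℝ)) G.hallRatio := by
  have hfin : Finite G.Subgraph := by
    refine Finite.of_injective (fun K : G.Subgraph => (K.verts, K.Adj)) ?_
    intro K L h
    simp only [Prod.mk.injEq] at h
    exact Subgraph.ext h.1 h.2
  exact ⟨Set.Nonempty.csSup_mem (Set.range_nonempty _) (Set.finite_range _),
    fun x hx => le_csSup (Set.finite_range _).bddAbove hx⟩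

end SimpleGraph

/-! The graph is random and bipartite. One side has `n 0` vertices, the other is a union of `K = 3 *
d` layers of sizes `n 0`, `n 1`, …, which decrease very fast, and each vertex of the first side
chooses one neighbour in each layer. This forces average degree at least `d`. By a union bound
(`LayerChoice.exists_isSparse`), some choice has no set of `r` vertices on one side giving two
neighbours each to `2 * r` vertices on the other, within the first `l + 1` layers and for all `r ≤
10 * n (l + 1)`.

Suppose the graph contains the `1`-subdivision of `H`. No edge of `H` joins branch vertices on
different sides, so the sides can be treated separately. For a set of `s` branch vertices,
`exists_scale` singles out one layer `j`: sparseness controls the layers before it, and the layers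
after it have at most `s / 9` vertices in total. Layer `j` itself is harmless, because each choosing
vertex has only one neighbour there. If the branch vertices choose, `H` has at most `(2 + 1 + 1 / 9)
* s` edges on them, and a weak Turán bound applies. If they lie in the layers, either those in layer
`j` form a large independent set, or most lie in earlier layers and span few edges. Hence `|H| ≤ 18
* α(H)`. Subgraphs of `H` inherit the containment, so this bounds the Hall ratio. -/

open Finset

/-! ### Independent sets in sparse graphs -/

/-- A weak form of Turán's theorem. -/
theorem SimpleGraph.exists_isIndepSet_mul_card_le {W : Type*} [Fintype W] [DecidableEq W]
    (H : SimpleGraph W) [DecidableRel H.Adj] (t : ℕ) (P : Finset W) :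
    ∃ I ⊆ P, H.IsIndepSet (I : Set W) ∧
      t * #P ≤ t ^ 2 * #I + #{e ∈ H.edgeFinset | ∀ v ∈ e, v ∈ P} := by
  induction P using Finset.strongInduction with
  | H P ih =>
  rcases P.eq_empty_or_nonempty with rfl | ⟨v₀, hv₀⟩
  · exact ⟨∅, by simp, by simp, by simp⟩
  -- Deleting a vertex of degree at least `t` costs `t` on the left and at least `t` edges on the
  -- right.
  by_cases hdeg : ∃ v ∈ P, t ≤ #{w ∈ P | H.Adj v w}
  · obtain ⟨v, hv, htv⟩ := hdeg
    obtain ⟨I, hIP, hI, hcard⟩ := ih (P.erase v) (erase_ssubset hv)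
    refine ⟨I, hIP.trans (erase_subset _ _), hI, ?_⟩
    have hdisj : Disjoint {e ∈ H.edgeFinset | ∀ w ∈ e, w ∈ P.erase v}
        ({w ∈ P | H.Adj v w}.image fun w => s(v, w)) := by
      rw [Finset.disjoint_left]
      intro e he he'
      obtain ⟨w, -, rfl⟩ := mem_image.1 he'
      simpa using (mem_filter.1 he).2 v (by simp)
    have hsub : {e ∈ H.edgeFinset | ∀ w ∈ e, w ∈ P.erase v} ∪
        ({w ∈ P | H.Adj v w}.image fun w => s(v, w)) ⊆
          {e ∈ H.edgeFinset | ∀ w ∈ e, w ∈ P} := by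
      intro e he
      rcases mem_union.1 he with he | he
      · rw [mem_filter] at he ⊢
        exact ⟨he.1, fun w hw => mem_of_mem_erase (he.2 w hw)⟩
      · obtain ⟨w, hw, rfl⟩ := mem_image.1 he
        rw [mem_filter] at hw
        simp [hw.1, hw.2, hv]
    have hle := card_le_card hsub
    rw [card_union_of_disjoint hdisj, card_image_of_injective _
      (fun a b hab => by simpa using Sym2.congr_right.1 hab)] at hle
    have hP := card_erase_add_one hv
    nlinarith
  · push Not at hdeg
    -- All degrees are below `t`: moving `v₀` into `I` discards at most `t` vertices, which the term
    -- `t ^ 2` pays for.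
    have hss : {w ∈ P | w ≠ v₀ ∧ ¬ H.Adj v₀ w} ⊂ P :=
      Finset.filter_ssubset.2 ⟨v₀, hv₀, by simp⟩
    obtain ⟨I, hIP, hI, hcard⟩ := ih _ hss
    have hv₀I : v₀ ∉ I := fun h => (mem_filter.1 (hIP h)).2.1 rfl
    refine ⟨insert v₀ I, insert_subset hv₀ (hIP.trans hss.1), ?_, ?_⟩
    · rw [coe_insert]
      refine Set.Pairwise.insert hI fun w hw _ => ?_
      have := (mem_filter.1 (hIP hw)).2.2
      exact ⟨this, fun h => this h.symm⟩
    · have hcov : P ⊆ {w ∈ P | w ≠ v₀ ∧ ¬ H.Adj v₀ w} ∪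
          insert v₀ {w ∈ P | H.Adj v₀ w} := by
        intro w hw
        simp only [mem_union, mem_filter, mem_insert]
        tauto
      have h1 := (card_le_card hcov).trans (card_union_le _ _)
      have h2 := card_insert_le v₀ {w ∈ P | H.Adj v₀ w}
      have h3 := hdeg v₀ hv₀
      have h4 : #{e ∈ H.edgeFinset | ∀ v ∈ e, v ∈ ({w ∈ P | w ≠ v₀ ∧ ¬ H.Adj v₀ w} : Finset W)}
          ≤ #{e ∈ H.edgeFinset | ∀ v ∈ e, v ∈ P} := by
        refine card_le_card fun e he => ?_
        rw [mem_filter] at he ⊢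
        exact ⟨he.1, fun w hw => hss.1 (he.2 w hw)⟩
      rw [card_insert_of_notMem hv₀I]
      have h5 : #P ≤ #{w ∈ P | w ≠ v₀ ∧ ¬ H.Adj v₀ w} + t := by omega
      have h6 := Nat.mul_le_mul_left t h5
      nlinarith

/-! ### Union bound for dense incidence structures -/

/-- A prescription of `#E` values of a function from a product of finite types, each of size at
least `q`, is satisfied by at most a fraction `q⁻¹ ^ #E` of all functions. -/
theorem card_filter_prescribed_mul_pow_le {ι : Type*} [Fintype ι] [DecidableEq ι] {α : ι → Type*}
    [∀ i, Fintype (α i)] [∀ i, DecidableEq (α i)] (E : Finset (Σ i, α i)) (q : ℕ)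
    (hq : ∀ p ∈ E, q ≤ Fintype.card (α p.1)) :
    #{f : ∀ i, α i | ∀ p ∈ E, f p.1 = p.2} * q ^ #E ≤ Fintype.card (∀ i, α i) := by
  rcases ({f : ∀ i, α i | ∀ p ∈ E, f p.1 = p.2} : Finset _).eq_empty_or_nonempty with h | ⟨f₀, hf₀⟩
  · rw [h]; simp
  simp only [mem_filter, mem_univ, true_and] at hf₀
  -- Since `f₀` satisfies the prescription, `E` prescribes at most one value per coordinate.
  have hE : #E = #(E.image Sigma.fst) := by
    refine (card_image_of_injOn ?_).symm
    rintro ⟨i, a⟩ hp ⟨i', a'⟩ hp' (rfl : i = i')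
    have h1 := hf₀ _ hp
    have h2 := hf₀ _ hp'
    exact congrArg _ (h1.symm.trans h2)
  have hsub : ({f : ∀ i, α i | ∀ p ∈ E, f p.1 = p.2} : Finset _) ⊆
      Fintype.piFinset fun i => if i ∈ E.image Sigma.fst then {f₀ i} else univ := by
    intro f hf
    simp only [mem_filter, mem_univ, true_and] at hf
    rw [Fintype.mem_piFinset]
    intro i
    split_ifs with hi
    · obtain ⟨p, hp, rfl⟩ := mem_image.1 hi
      rw [mem_singleton, hf p hp, hf₀ p hp]
    · exact mem_univ _
  have hpow : q ^ #E = ∏ i, if i ∈ E.image Sigma.fst then q else 1 := by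
    rw [hE, prod_ite_mem, univ_inter, prod_const]
  calc _ ≤ (∏ i, #(if i ∈ E.image Sigma.fst then {f₀ i} else univ)) * q ^ #E := by
        rw [← Fintype.card_piFinset]
        exact Nat.mul_le_mul_right _ (card_le_card hsub)
    _ ≤ ∏ i, Fintype.card (α i) := by
        rw [hpow, ← prod_mul_distrib]
        refine prod_le_prod' fun i _ => ?_
        split_ifs with hi
        · obtain ⟨p, hp, rfl⟩ := mem_image.1 hi
          simpa using hq p hp
        · simp
    _ = _ := Fintype.card_pi.symm

theorem card_biUnion_mul_le {ι Ω : Type*} [DecidableEq Ω] (s : Finset ι) (F : ι → Finset Ω)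
    (Q N : ℕ) (h : ∀ i ∈ s, #(F i) * Q ≤ N) : #(s.biUnion F) * Q ≤ #s * N :=
  calc #(s.biUnion F) * Q ≤ (∑ i ∈ s, #(F i)) * Q := Nat.mul_le_mul_right _ card_biUnion_le
    _ = ∑ i ∈ s, #(F i) * Q := sum_mul ..
    _ ≤ #s * N := sum_le_card_nsmul _ _ _ h

/-- Every element of `T` has two neighbours in `S` under `R`. -/
def EachHasTwoNeighbors {X Y : Type*} (R : X → Y → Prop) (S : Finset X) (T : Finset Y) : Prop :=
  ∀ t ∈ T, ∃ x ∈ S, ∃ y ∈ S, x ≠ y ∧ R x t ∧ R y t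

/-- All pairs in `E` are related by `R`. -/
def RelatesAll {X Y : Type*} (R : X → Y → Prop) (E : Finset (X × Y)) : Prop :=
  ∀ p ∈ E, R p.1 p.2

/-- Some `u` elements all have two neighbours in a common set of `r` elements. -/
def HasDenseIncidence {X Y : Type*} (R : X → Y → Prop) (r u : ℕ) : Prop :=
  ∃ S T, #S = r ∧ #T = u ∧ EachHasTwoNeighbors R S T

open Classical in
/-- A union bound for random relations containing a dense incidence structure. -/
theorem card_filter_hasDenseIncidence_mul_pow_le {Ω X Y : Type*} [Fintype Ω] [Fintype X]
    [Fintype Y] (R : Ω → X → Y → Prop) (q : ℕ)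
    (hR : ∀ E : Finset (X × Y), #{ω | RelatesAll (R ω) E} * q ^ #E ≤ Fintype.card Ω)
    (r u : ℕ) :
    #{ω | HasDenseIncidence (R ω) r u} * q ^ (2 * u) ≤
      (Fintype.card X).choose r * ((Fintype.card Y).choose u * ((r * r) ^ u * Fintype.card Ω)) := by
  have key : ∀ S ∈ (univ : Finset X).powersetCard r, ∀ T ∈ (univ : Finset Y).powersetCard u,
      #{ω | EachHasTwoNeighbors (R ω) S T} * q ^ (2 * u) ≤ (r * r) ^ u * Fintype.card Ω := by
    intro S hS T hT
    rw [mem_powersetCard_univ] at hS hT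
    -- `g` names two neighbours in `S` for each `t`. There are `(r * r) ^ u` such `g`, and each
    -- relevant one prescribes `2 * u` distinct pairs.
    let F : (T → S × S) → Finset Ω := fun g => if ∀ t, (g t).1 ≠ (g t).2 then
      univ.filter (fun ω => ∀ t : T, R ω (g t).1 t ∧ R ω (g t).2 t) else ∅
    have hsub : ({ω | EachHasTwoNeighbors (R ω) S T} : Finset Ω) ⊆ univ.biUnion F := by
      intro ω hω
      choose x hx y hy hxy hRx hRy using (mem_filter.1 hω).2
      refine mem_biUnion.2
        ⟨fun t => (⟨x t t.2, hx t t.2⟩, ⟨y t t.2, hy t t.2⟩), mem_univ _, ?_⟩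
      have : ∀ t : T, x t t.2 ≠ y t t.2 := fun t => hxy t t.2
      simp only [F]
      rw [if_pos (fun t h => this t (congrArg Subtype.val h))]
      simp only [mem_filter, mem_univ, true_and]
      exact fun t => ⟨hRx t t.2, hRy t t.2⟩
    refine (Nat.mul_le_mul_right _ (card_le_card hsub)).trans ?_
    have hcard : #(univ : Finset (T → S × S)) = (r * r) ^ u := by
      simp [hS, hT]
    rw [← hcard]
    refine card_biUnion_mul_le _ _ _ _ fun g _ => ?_
    by_cases hg : ∀ t, (g t).1 ≠ (g t).2
    · let E : Finset (X × Y) := (univ : Finset (T × Bool)).image fun p =>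
        (if p.2 then ((g p.1).1 : X) else ((g p.1).2 : X), (p.1 : Y))
      have hE : #E = 2 * u := by
        rw [card_image_of_injective]
        · simp [hT, mul_comm]
        · rintro ⟨t, a⟩ ⟨t', a'⟩ h
          simp only [Prod.mk.injEq] at h
          obtain ⟨h1, h2⟩ := h
          obtain rfl : t = t' := Subtype.ext h2
          have := hg t
          rw [Ne, Subtype.ext_iff] at this
          cases a <;> cases a' <;> first
            | rfl
            | exact absurd h1 this
            | exact absurd h1.symm this
      rw [← hE]
      refine (Nat.mul_le_mul_right _ (card_le_card ?_)).trans (hR E)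
      intro ω hω
      simp only [F, if_pos hg, mem_filter, mem_univ, true_and] at hω
      refine mem_filter.2 ⟨mem_univ _, ?_⟩
      intro p hp
      obtain ⟨⟨t, a⟩, -, rfl⟩ := mem_image.1 hp
      cases a
      · exact (hω t).2
      · exact (hω t).1
    · simp only [F, if_neg hg, card_empty, zero_mul, Nat.zero_le]
  have hsub : ({ω | HasDenseIncidence (R ω) r u} : Finset Ω) ⊆
      ((univ : Finset X).powersetCard r).biUnion fun S =>
        ((univ : Finset Y).powersetCard u).biUnion fun T =>
          {ω | EachHasTwoNeighbors (R ω) S T} := by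
    intro ω hω
    obtain ⟨S, T, hS, hT, h⟩ := (mem_filter.1 hω).2
    refine mem_biUnion.2 ⟨S, by simpa [mem_powersetCard_univ] using hS, mem_biUnion.2
      ⟨T, by simpa [mem_powersetCard_univ] using hT, by simpa using h⟩⟩
  refine (Nat.mul_le_mul_right _ (card_le_card hsub)).trans ?_
  have hX : (Fintype.card X).choose r = #((univ : Finset X).powersetCard r) := by
    rw [card_powersetCard, card_univ]
  have hY : (Fintype.card Y).choose u = #((univ : Finset Y).powersetCard u) := by
    rw [card_powersetCard, card_univ]
  rw [hX, hY]
  exact card_biUnion_mul_le _ _ _ _ fun S hS => card_biUnion_mul_le _ _ _ _ fun T hT =>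
    key S hS T hT

/-! ### Binomial estimates -/

theorem Nat.pow_self_le_three_pow_mul_factorial (r : ℕ) : r ^ r ≤ 3 ^ r * r.factorial := by
  have h := Real.pow_div_factorial_le_exp (r : ℝ) (Nat.cast_nonneg r) r
  have h3 : Real.exp (r : ℝ) ≤ 3 ^ r := by
    rw [← Real.exp_one_pow]
    exact pow_le_pow_left₀ (Real.exp_pos _).le Real.exp_one_lt_three.le r
  rw [div_le_iff₀ (by positivity)] at h
  have : (r : ℝ) ^ r ≤ 3 ^ r * r.factorial := h.trans (by gcongr)
  exact_mod_cast this

theorem Nat.choose_mul_pow_self_le (M r : ℕ) : M.choose r * r ^ r ≤ (3 * M) ^ r := by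
  calc M.choose r * r ^ r ≤ M.choose r * (3 ^ r * r.factorial) :=
        Nat.mul_le_mul_left _ (Nat.pow_self_le_three_pow_mul_factorial r)
    _ = 3 ^ r * (r.factorial * M.choose r) := by ring
    _ ≤ 3 ^ r * M ^ r := by
        rw [← Nat.descFactorial_eq_factorial_mul_choose]
        exact Nat.mul_le_mul_left _ (Nat.descFactorial_le_pow _ _)
    _ = (3 * M) ^ r := (mul_pow ..).symm

/-- Of the factor `r ^ (4 * r)`, the two binomials absorb `r ^ (3 * r)`, leaving `r ^ r`. The
constant is `54 = 6 * 3 ^ 2`. -/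
theorem choose_mul_choose_mul_pow_le {X Y n r : ℕ} (hX : X ≤ 2 * n) (hY : Y ≤ 2 * n) :
    X.choose r * (Y.choose (2 * r) * (r * r) ^ (2 * r)) ≤ (54 * n ^ 3 * r) ^ r := by
  have h1 : X.choose r * r ^ r ≤ (6 * n) ^ r :=
    (Nat.choose_mul_pow_self_le X r).trans (Nat.pow_le_pow_left (by omega) r)
  have h2 : Y.choose (2 * r) * r ^ (2 * r) ≤ (3 * n) ^ (2 * r) := by
    have := (Nat.choose_mul_pow_self_le Y (2 * r)).trans
      (Nat.pow_le_pow_left (show 3 * Y ≤ 2 * (3 * n) by omega) (2 * r))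
    rw [mul_pow, mul_pow 2 (3 * n), mul_left_comm] at this
    exact Nat.le_of_mul_le_mul_left this (by positivity)
  calc _ = (X.choose r * r ^ r) * (Y.choose (2 * r) * r ^ (2 * r)) * r ^ r := by
        rw [mul_pow r r]; ring
    _ ≤ (6 * n) ^ r * (3 * n) ^ (2 * r) * r ^ r := by gcongr
    _ = _ := by rw [pow_mul, ← mul_pow, ← mul_pow]; ring

/-! ### Layer sizes -/

/-- The exponents `0, 1, 5, 21, …`. -/
def layerExponent : ℕ → ℕ
  | 0 => 0
  | i + 1 => 4 * layerExponent i + 1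

theorem layerExponent_mono : Monotone layerExponent :=
  monotone_nat_of_le_succ fun i => by simp only [layerExponent]; omega

/-- Rapidly decreasing layer sizes. -/
def layerSize (c K i : ℕ) : ℕ := c ^ (layerExponent K - layerExponent i)

theorem layerSize_pos {c : ℕ} (hc : 0 < c) (K i : ℕ) : 0 < layerSize c K i :=
  Nat.pow_pos hc

theorem layerSize_antitone {c : ℕ} (hc : 0 < c) (K : ℕ) : Antitone (layerSize c K) :=
  fun _ _ hij => Nat.pow_le_pow_right hc (Nat.sub_le_sub_left (layerExponent_mono hij) _)

/-- The recursion `4 * e + 1` of the exponents is chosen to make this an equality. It is the growth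
condition that the union bound requires. -/
theorem mul_layerSize_succ_mul_pow (c K i : ℕ) (hi : i < K) :
    c * (layerSize c K (i + 1) * layerSize c K 0 ^ 3) = layerSize c K i ^ 4 := by
  have h : layerExponent (i + 1) ≤ layerExponent K := layerExponent_mono hi
  simp only [layerSize, layerExponent] at h ⊢
  rw [← pow_mul, ← pow_mul, ← pow_add, ← pow_succ']
  congr 1
  omega

theorem mul_layerSize_succ_le {c : ℕ} (hc : 0 < c) (K i : ℕ) (hi : i < K) :
    c * layerSize c K (i + 1) ≤ layerSize c K i := by
  have h : layerExponent (i + 1) ≤ layerExponent K := layerExponent_mono hi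
  simp only [layerSize, layerExponent] at h ⊢
  rw [← pow_succ']
  exact Nat.pow_le_pow_right hc (by omega)

/-- Telescoping: `9 * n i ≤ 10 * n i - 10 * n (i + 1)`. -/
theorem nine_mul_sum_Ico_le {n : ℕ → ℕ} {a b : ℕ} (hab : a ≤ b)
    (h : ∀ i < b, 10 * n (i + 1) ≤ n i) :
    9 * ∑ i ∈ Ico a b, n i + 10 * n b ≤ 10 * n a := by
  induction b, hab using Nat.le_induction with
  | base => simp
  | succ k hk ih =>
    rw [sum_Ico_succ_top hk]
    have := ih fun i hi => h i (by omega)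
    have := h k (by omega)
    omega

/-! ### Random choices and the existence of a sparse one -/

/-- A choice of one vertex in each of `K` layers for each of `n 0` vertices. -/
def LayerChoice (n : ℕ → ℕ) (K : ℕ) : Type := ∀ p : Fin (n 0) × Fin K, Fin (n p.2)

instance (n : ℕ → ℕ) (K : ℕ) : Fintype (LayerChoice n K) :=
  inferInstanceAs (Fintype (∀ p : Fin (n 0) × Fin K, Fin (n p.2)))

/-- The vertices of all `K` layers. -/
abbrev LayerVertex (n : ℕ → ℕ) (K : ℕ) : Type := Σ i : Fin K, Fin (n i)

/-- `b` is chosen by `a`, and lies in one of the first `j` layers. -/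
def LayerChoice.Rel {n : ℕ → ℕ} {K : ℕ} (f : LayerChoice n K) (j : ℕ) (a : Fin (n 0))
    (b : LayerVertex n K) : Prop :=
  (b.1 : ℕ) < j ∧ f (a, b.1) = b.2

-- Only layers `0, …, l` matter, each of size at least `n l`; a pair in a later layer makes the
-- event empty.
open Classical in
theorem LayerChoice.card_filter_rel_mul_pow_le {n : ℕ → ℕ} (hn : Antitone n) {K l : ℕ}
    (E : Finset (Fin (n 0) × LayerVertex n K)) :
    #{f : LayerChoice n K | RelatesAll (f.Rel (l + 1)) E} * n l ^ #E ≤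
      Fintype.card (LayerChoice n K) := by
  by_cases hE : ∀ p ∈ E, (p.2.1 : ℕ) < l + 1
  · let g : Fin (n 0) × LayerVertex n K → Σ p : Fin (n 0) × Fin K, Fin (n p.2) :=
      fun p => ⟨(p.1, p.2.1), p.2.2⟩
    have hg : Function.Injective g := by
      rintro ⟨a, i, b⟩ ⟨a', i', b'⟩ h
      simp only [g, Sigma.mk.injEq, Prod.mk.injEq] at h
      obtain ⟨⟨rfl, rfl⟩, h⟩ := h
      rw [eq_of_heq h]
    have hcard : #E = #(E.image g) := (card_image_of_injective _ hg).symm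
    rw [hcard]
    refine le_trans (Nat.mul_le_mul_right _ (card_le_card ?_))
      (card_filter_prescribed_mul_pow_le (E.image g) (n l) ?_)
    · intro f hf
      rw [mem_filter] at hf
      refine mem_filter.2 ⟨mem_univ (α := ∀ p : Fin (n 0) × Fin K, Fin (n p.2)) f, fun p hp => ?_⟩
      obtain ⟨p, hpE, rfl⟩ := mem_image.1 hp
      exact (hf.2 p hpE).2
    · intro p hp
      obtain ⟨p, hpE, rfl⟩ := mem_image.1 hp
      rw [Fintype.card_fin]
      exact hn (Nat.lt_succ_iff.1 (hE p hpE))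
  · push Not at hE
    obtain ⟨p, hp, hpl⟩ := hE
    rw [filter_false_of_mem, card_empty, zero_mul]
    · exact Nat.zero_le _
    · exact fun f _ h => absurd (h p hp).1 (by omega)

open Classical in
theorem LayerChoice.card_filter_flip_rel_mul_pow_le {n : ℕ → ℕ} (hn : Antitone n) {K l : ℕ}
    (E : Finset (LayerVertex n K × Fin (n 0))) :
    #{f : LayerChoice n K | RelatesAll (flip (f.Rel (l + 1))) E} * n l ^ #E ≤
      Fintype.card (LayerChoice n K) := by
  have h := LayerChoice.card_filter_rel_mul_pow_le hn (l := l) (E.image Prod.swap)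
  rw [card_image_of_injective _ Prod.swap_injective] at h
  refine (Nat.mul_le_mul_right _ (card_le_card ?_)).trans h
  intro f hf
  rw [mem_filter] at hf ⊢
  refine ⟨hf.1, fun p hp => ?_⟩
  obtain ⟨p, hpE, rfl⟩ := mem_image.1 hp
  exact hf.2 p hpE

/-- The union bound becomes a probability of at most `(8 * K) ^ (-r)`, where `4320 = 8 * 54 * 10`.
-/
theorem mul_pow_le_of_mul_pow_le {b N n q q' r X Y K : ℕ} (hX : X ≤ 2 * n) (hY : Y ≤ 2 * n)
    (hn : 0 < n) (hr : 1 ≤ r) (hrq : r ≤ 10 * q') (hq : 4320 * K * (q' * n ^ 3) ≤ q ^ 4)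
    (h : b * q ^ (2 * (2 * r)) ≤
      X.choose r * (Y.choose (2 * r) * ((r * r) ^ (2 * r) * N))) :
    b * (8 * K) ^ r ≤ N := by
  have h1 : X.choose r * (Y.choose (2 * r) * ((r * r) ^ (2 * r) * N)) ≤
      (54 * n ^ 3 * r) ^ r * N := by
    have := Nat.mul_le_mul_right N (choose_mul_choose_mul_pow_le (r := r) hX hY)
    calc _ = _ := by ring
      _ ≤ _ := this
  have h2 : 8 * K * (54 * n ^ 3 * r) ≤ q ^ 4 := by
    calc 8 * K * (54 * n ^ 3 * r) ≤ 8 * K * (54 * n ^ 3 * (10 * q')) := by gcongr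
      _ = 4320 * K * (q' * n ^ 3) := by ring
      _ ≤ _ := hq
  have h3 : (8 * K) ^ r * (54 * n ^ 3 * r) ^ r ≤ q ^ (2 * (2 * r)) := by
    rw [← mul_pow, show 2 * (2 * r) = 4 * r by ring, pow_mul]
    exact Nat.pow_le_pow_left h2 r
  refine le_of_mul_le_mul_left (a := (54 * n ^ 3 * r) ^ r) ?_ (by positivity)
  calc (54 * n ^ 3 * r) ^ r * (b * (8 * K) ^ r)
        = b * ((8 * K) ^ r * (54 * n ^ 3 * r) ^ r) := by ring
    _ ≤ b * q ^ (2 * (2 * r)) := Nat.mul_le_mul_left _ h3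
    _ ≤ _ := h.trans h1

theorem sum_inv_eight_pow_le (R : ℕ) : ∑ r ∈ range R, ((1 : ℝ) / 8) ^ (r + 1) ≤ 1 / 7 := by
  have h : ∑ r ∈ range R, ((1 : ℝ) / 8) ^ (r + 1) = 1 / 7 - 1 / 7 * (1 / 8) ^ R := by
    induction R with
    | zero => simp
    | succ R ih => rw [sum_range_succ, ih, pow_succ]; ring
  rw [h]
  have : (0 : ℝ) ≤ 1 / 7 * (1 / 8) ^ R := by positivity
  linarith

/-- No small dense incidence structure lives on the first `l + 1` layers, at the scale of the
layer after those. -/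
def LayerChoice.IsSparse {n : ℕ → ℕ} {K : ℕ} (f : LayerChoice n K) : Prop :=
  ∀ l < K, ∀ r, 1 ≤ r → r ≤ 10 * n (l + 1) →
    ¬ HasDenseIncidence (f.Rel (l + 1)) r (2 * r) ∧
    ¬ HasDenseIncidence (flip (f.Rel (l + 1))) r (2 * r)

open Classical in
theorem card_filter_hasDenseIncidence_mul_le {Ω X Y : Type*} [Fintype Ω] [Fintype X]
    [Fintype Y] (R : Ω → X → Y → Prop) {n q q' r K : ℕ}
    (hR : ∀ E : Finset (X × Y), #{ω | RelatesAll (R ω) E} * q ^ #E ≤ Fintype.card Ω)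
    (hX : Fintype.card X ≤ 2 * n) (hY : Fintype.card Y ≤ 2 * n)
    (hn : 0 < n) (hr : 1 ≤ r) (hrq : r ≤ 10 * q') (hq : 4320 * K * (q' * n ^ 3) ≤ q ^ 4) :
    #{ω | HasDenseIncidence (R ω) r (2 * r)} * (8 * K) ^ r ≤
      Fintype.card Ω :=
  mul_pow_le_of_mul_pow_le hX hY hn hr hrq hq
    (card_filter_hasDenseIncidence_mul_pow_le R q hR r (2 * r))

open Classical in
theorem LayerChoice.card_filter_hasDenseIncidence_rel {n : ℕ → ℕ} (hn : Antitone n) {K l r : ℕ}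
    (hA : Fintype.card (Fin (n 0)) ≤ 2 * n 0) (hB : Fintype.card (LayerVertex n K) ≤ 2 * n 0)
    (h0 : 0 < n 0) (hr : 1 ≤ r) (hrq : r ≤ 10 * n (l + 1))
    (hgrow : 4320 * K * (n (l + 1) * n 0 ^ 3) ≤ n l ^ 4) :
    #{f : LayerChoice n K | HasDenseIncidence (f.Rel (l + 1)) r (2 * r)} * (8 * K) ^ r ≤
      Fintype.card (LayerChoice n K) :=
  card_filter_hasDenseIncidence_mul_le (n := n 0) (q := n l) (q' := n (l + 1))
    (fun f : LayerChoice n K => f.Rel (l + 1))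
    (LayerChoice.card_filter_rel_mul_pow_le hn) hA hB h0 hr hrq hgrow

open Classical in
theorem LayerChoice.card_filter_hasDenseIncidence_flip {n : ℕ → ℕ} (hn : Antitone n) {K l r : ℕ}
    (hA : Fintype.card (Fin (n 0)) ≤ 2 * n 0) (hB : Fintype.card (LayerVertex n K) ≤ 2 * n 0)
    (h0 : 0 < n 0) (hr : 1 ≤ r) (hrq : r ≤ 10 * n (l + 1))
    (hgrow : 4320 * K * (n (l + 1) * n 0 ^ 3) ≤ n l ^ 4) :
    #{f : LayerChoice n K | HasDenseIncidence (flip (f.Rel (l + 1))) r (2 * r)} * (8 * K) ^ r ≤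
      Fintype.card (LayerChoice n K) :=
  card_filter_hasDenseIncidence_mul_le (n := n 0) (q := n l) (q' := n (l + 1))
    (fun f : LayerChoice n K => flip (f.Rel (l + 1)))
    (LayerChoice.card_filter_flip_rel_mul_pow_le hn) hB hA h0 hr hrq hgrow

-- The bad events have total probability at most `2 / 7`: there are two sides, `K` values of `l`,
-- and a geometric series in `1 / 8` over `r`, with one factor `1 / K` to offset the number of
-- layers.
open Classical in
theorem LayerChoice.exists_isSparse {n : ℕ → ℕ} {K : ℕ} (hpos : ∀ i, 0 < n i) (hn : Antitone n)
    (hgrow : ∀ i < K, 4320 * K * (n (i + 1) * n 0 ^ 3) ≤ n i ^ 4)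
    (hsum : ∑ i : Fin K, n i ≤ 2 * n 0) :
    ∃ f : LayerChoice n K, f.IsSparse := by
  rcases Nat.eq_zero_or_pos K with rfl | hK
  · exact ⟨fun p => p.2.elim0, fun l hl => absurd hl (Nat.not_lt_zero l)⟩
  by_contra! hcon
  have hA : Fintype.card (Fin (n 0)) ≤ 2 * n 0 := by rw [Fintype.card_fin]; omega
  have hB : Fintype.card (LayerVertex n K) ≤ 2 * n 0 := by simpa using hsum
  let F₁ : ℕ → ℕ → Finset (LayerChoice n K) := fun l r =>
    {f | HasDenseIncidence (f.Rel (l + 1)) r (2 * r)}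
  let F₂ : ℕ → ℕ → Finset (LayerChoice n K) := fun l r =>
    {f | HasDenseIncidence (flip (f.Rel (l + 1))) r (2 * r)}
  let F : ℕ → ℕ → Finset (LayerChoice n K) := fun l r =>
    if r ≤ 10 * n (l + 1) then F₁ l r ∪ F₂ l r else ∅
  set N := Fintype.card (LayerChoice n K) with hN
  have hNpos : 0 < N := Fintype.card_pos_iff.2 ⟨fun p => ⟨0, hpos _⟩⟩
  have hcover : (univ : Finset (LayerChoice n K)) ⊆
      (range K).biUnion fun l => (range (10 * n 0)).biUnion fun r => F l (r + 1) := by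
    intro f _
    have := hcon f
    simp only [LayerChoice.IsSparse] at this
    push Not at this
    obtain ⟨l, hl, r, hr, hrn, h⟩ := this
    have hn0 : n (l + 1) ≤ n 0 := hn (Nat.zero_le _)
    refine mem_biUnion.2 ⟨l, mem_range.2 hl, mem_biUnion.2 ⟨r - 1, mem_range.2 (by omega), ?_⟩⟩
    rw [Nat.sub_add_cancel hr]
    simp only [F, if_pos hrn, F₁, F₂, mem_union, mem_filter, mem_univ, true_and]
    tauto
  have hF : ∀ l ∈ range K, ∀ r, (#(F l (r + 1)) : ℝ) ≤ 2 * N / K * (1 / 8) ^ (r + 1) := by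
    intro l hl r
    rw [mem_range] at hl
    by_cases hr : r + 1 ≤ 10 * n (l + 1)
    · have h₁ : #(F₁ l (r + 1)) * (8 * K) ^ (r + 1) ≤ N :=
        LayerChoice.card_filter_hasDenseIncidence_rel hn hA hB (hpos 0) le_add_self hr (hgrow l hl)
      have h₂ : #(F₂ l (r + 1)) * (8 * K) ^ (r + 1) ≤ N :=
        LayerChoice.card_filter_hasDenseIncidence_flip hn hA hB (hpos 0) le_add_self hr
          (hgrow l hl)
      have h₃ : #(F l (r + 1)) * (8 ^ (r + 1) * K) ≤ 2 * N := by
        simp only [F, if_pos hr]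
        -- A single factor `K` suffices to pay for the sum over `l`.
        have hle : 8 ^ (r + 1) * K ≤ (8 * K) ^ (r + 1) := by
          rw [mul_pow]
          exact Nat.mul_le_mul_left _ (Nat.le_self_pow (by omega) K)
        calc _ ≤ (#(F₁ l (r + 1)) + #(F₂ l (r + 1))) * (8 * K) ^ (r + 1) :=
              Nat.mul_le_mul (card_union_le _ _) hle
          _ ≤ 2 * N := by rw [add_mul]; omega
      have h₄ : (#(F l (r + 1)) : ℝ) * (8 ^ (r + 1) * K) ≤ 2 * N := by exact_mod_cast h₃
      have hK' : (0 : ℝ) < K := by exact_mod_cast hK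
      rw [one_div, inv_pow, ← div_eq_mul_inv, div_div, le_div_iff₀ (by positivity)]
      linarith
    · simp only [F, if_neg hr, card_empty, Nat.cast_zero]
      positivity
  have htotal : (N : ℝ) ≤ 2 * N / 7 := by
    have hK' : (0 : ℝ) < K := by exact_mod_cast hK
    have h1 : N ≤ ∑ l ∈ range K, ∑ r ∈ range (10 * n 0), #(F l (r + 1)) := by
      rw [hN, ← card_univ]
      exact (card_le_card hcover).trans
        (card_biUnion_le.trans (sum_le_sum fun l _ => card_biUnion_le))
    calc (N : ℝ) ≤ ∑ l ∈ range K, ∑ r ∈ range (10 * n 0), (#(F l (r + 1)) : ℝ) := by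
          exact_mod_cast h1
      _ ≤ ∑ l ∈ range K, 2 * (N : ℝ) / K * (1 / 7) := by
          refine sum_le_sum fun l hl => (sum_le_sum fun r _ => hF l hl r).trans ?_
          rw [← mul_sum]
          exact mul_le_mul_of_nonneg_left (sum_inv_eight_pow_le _) (by positivity)
      _ = 2 * N / 7 := by
          rw [sum_const, card_range, nsmul_eq_mul]
          field_simp
  have : (0 : ℝ) < N := by exact_mod_cast hNpos
  linarith

/-! ### The bipartite graph and its average degree -/

/-- The bipartite graph joining every `a` to its choices. -/
def LayerChoice.graph {n : ℕ → ℕ} {K : ℕ} (f : LayerChoice n K) :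
    SimpleGraph (Fin (n 0) ⊕ LayerVertex n K) where
  Adj
    | Sum.inl a, Sum.inr b => f (a, b.1) = b.2
    | Sum.inr b, Sum.inl a => f (a, b.1) = b.2
    | Sum.inl _, Sum.inl _ => False
    | Sum.inr _, Sum.inr _ => False
  symm := ⟨by rintro (a | b) (a' | b') h <;> exact h⟩
  loopless := ⟨by rintro (a | b) h <;> exact h⟩

theorem LayerChoice.isBipartite_graph {n : ℕ → ℕ} {K : ℕ} (f : LayerChoice n K) :
    f.graph.IsBipartite :=
  ⟨SimpleGraph.Coloring.mk (Sum.elim (fun _ => 0) fun _ => 1) (by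
    rintro (a | b) (a' | b') h
    · exact h.elim
    · simp
    · simp
    · exact h.elim)⟩

/-- Counting degrees on the choosing side alone gives `K * n 0`, against at most `3 * n 0` vertices.
-/
theorem LayerChoice.le_averageDegree_graph {n : ℕ → ℕ} {K : ℕ} (f : LayerChoice n K)
    [DecidableRel f.graph.Adj] (h0 : 0 < n 0) (hsum : ∑ i : Fin K, n i ≤ 2 * n 0) :
    (K : ℝ) / 3 ≤ f.graph.averageDegree := by
  have hdeg : ∀ a : Fin (n 0), K ≤ f.graph.degree (Sum.inl a) := by
    intro a
    have hinj : Function.Injective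
        fun i : Fin K => (Sum.inr ⟨i, f (a, i)⟩ : Fin (n 0) ⊕ LayerVertex n K) := by
      intro i i' h
      simp only [Sum.inr.injEq, Sigma.mk.injEq] at h
      exact h.1
    calc K = #(univ.image fun i : Fin K =>
          (Sum.inr ⟨i, f (a, i)⟩ : Fin (n 0) ⊕ LayerVertex n K)) := by
          rw [card_image_of_injective _ hinj, card_univ, Fintype.card_fin]
      _ ≤ f.graph.degree (Sum.inl a) := by
          rw [← SimpleGraph.card_neighborFinset_eq_degree]
          refine card_le_card fun v hv => ?_
          obtain ⟨i, -, rfl⟩ := mem_image.1 hv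
          rw [SimpleGraph.mem_neighborFinset]
          exact rfl
  have hnum : K * n 0 ≤ ∑ v, f.graph.degree v := by
    rw [Fintype.sum_sum_type]
    refine le_trans ?_ (Nat.le_add_right _ _)
    calc K * n 0 = ∑ _a : Fin (n 0), K := by simp [mul_comm]
      _ ≤ _ := sum_le_sum fun a _ => hdeg a
  have hcard : Fintype.card (Fin (n 0) ⊕ LayerVertex n K) ≤ 3 * n 0 := by
    have : Fintype.card (LayerVertex n K) ≤ 2 * n 0 := by simpa using hsum
    rw [Fintype.card_sum, Fintype.card_fin]
    omega
  have hcard0 : 0 < Fintype.card (Fin (n 0) ⊕ LayerVertex n K) := by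
    rw [Fintype.card_sum, Fintype.card_fin]
    omega
  have hnum' : (K : ℝ) * n 0 ≤ ∑ v, (f.graph.degree v : ℝ) := by exact_mod_cast hnum
  have hcard' : (Fintype.card (Fin (n 0) ⊕ LayerVertex n K) : ℝ) ≤ 3 * n 0 := by
    exact_mod_cast hcard
  have hcard0' : (0 : ℝ) < Fintype.card (Fin (n 0) ⊕ LayerVertex n K) := by
    exact_mod_cast hcard0
  rw [SimpleGraph.averageDegree, le_div_iff₀ hcard0']
  have hK : (0 : ℝ) ≤ K := Nat.cast_nonneg K
  nlinarith [mul_le_mul_of_nonneg_left hcard' hK]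

/-! ### Independent sets of branch vertices -/

theorem card_filter_layerVertex_le {n : ℕ → ℕ} {K j : ℕ} (P : Finset (LayerVertex n K))
    (hP : ∀ b ∈ P, j ≤ (b.1 : ℕ)) : #P ≤ ∑ i ∈ Ico j K, n i := by
  have hsub : P ⊆ (univ.filter fun i : Fin K => j ≤ (i : ℕ)).sigma fun _ => univ := by
    intro b hb
    simp [hP b hb]
  refine (card_le_card hsub).trans ?_
  rw [card_sigma]
  simp only [card_univ, Fintype.card_fin]
  rw [sum_filter, Fin.sum_univ_eq_sum_range (fun i => if j ≤ i then n i else 0) K,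
    ← sum_filter]
  refine (sum_congr ?_ fun _ _ => rfl).le
  ext i
  simp only [mem_filter, mem_range, mem_Ico]
  omega

/-- The scale of a set of size `s`: layers after the `j`-th are small compared to `s`, and `s` is
small compared to layers before the `j`-th. -/
theorem exists_scale {n : ℕ → ℕ} (K : ℕ) (hdec : ∀ i < K, 10 * n (i + 1) ≤ n i) {s : ℕ}
    (hs : s ≤ 10 * n 0) : ∃ j ≤ K, s ≤ 10 * n j ∧ 9 * ∑ i ∈ Ico (j + 1) K, n i ≤ s := by
  classical
  -- The guard `j < K` admits `j = K`, where every layer lies before the scale and none after it.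
  have hex : ∃ j, j ≤ K ∧ s ≤ 10 * n j ∧ (j < K → ¬ s ≤ 10 * n (j + 1)) := by
    by_contra! hcon
    have hall : ∀ j ≤ K, s ≤ 10 * n j := by
      intro j
      induction j with
      | zero => exact fun _ => hs
      | succ j ih => exact fun hj => (hcon j (by omega) (ih (by omega))).2
    have := (hcon K le_rfl (hall K le_rfl)).1
    omega
  obtain ⟨j, hj, hsj, hj'⟩ := hex
  refine ⟨j, hj, hsj, ?_⟩
  rcases hj.lt_or_eq with hlt | rfl
  · have h1 := nine_mul_sum_Ico_le (show j + 1 ≤ K from hlt) hdec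
    have h2 := hj' hlt
    omega
  · simp

/-- If at most `28 / 9 * #P` edges lie inside `P`, then `P` contains a large independent set. -/
theorem SimpleGraph.exists_isIndepSet_of_card_edges_le {W : Type*} [Fintype W] [DecidableEq W]
    (H : SimpleGraph W) [DecidableRel H.Adj] (P : Finset W)
    (hP : 9 * #{e ∈ H.edgeFinset | ∀ v ∈ e, v ∈ P} ≤ 28 * #P) :
    ∃ I ⊆ P, H.IsIndepSet (I : Set W) ∧ 26 * #P ≤ 324 * #I := by
  -- With `t = 6`: `(54 - 28) * #P ≤ 9 * 36 * #I`.
  obtain ⟨I, hIP, hI, h⟩ := H.exists_isIndepSet_mul_card_le 6 P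
  exact ⟨I, hIP, hI, by omega⟩

open Classical in
/-- If `R` has no dense incidence structure, at most `2 * #P` edges inside `P` can be subdivided
along `R`. -/
theorem card_le_two_mul_of_not_hasDenseIncidence {W X Y : Type*} [Fintype W]
    (H : SimpleGraph W) (R : X → Y → Prop) (P : Finset W) (D : Finset (Sym2 W))
    (x : W → X) (y : Sym2 W → Y)
    (hx : Set.InjOn x P) (hy : Set.InjOn y D) (hDH : ∀ e ∈ D, e ∈ H.edgeSet)
    (hD : ∀ e ∈ D, ∀ v ∈ e, v ∈ P) (hR : ∀ e ∈ D, ∀ v ∈ e, R (x v) (y e))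
    (h : ¬ HasDenseIncidence R #P (2 * #P)) : #D ≤ 2 * #P := by
  by_contra! hlt
  refine h ?_
  obtain ⟨D', hD'D, hD'⟩ := exists_subset_card_eq hlt.le
  refine ⟨P.image x, D'.image y, card_image_of_injOn hx, ?_, ?_⟩
  · rw [card_image_of_injOn (hy.mono hD'D), hD']
  · intro t ht
    obtain ⟨e, he, rfl⟩ := mem_image.1 ht
    have heD := hD'D he
    induction e using Sym2.ind with
    | _ v w =>
      have hv := hD _ heD v (by simp)
      have hw := hD _ heD w (by simp)
      refine ⟨x v, mem_image_of_mem _ hv, x w, mem_image_of_mem _ hw, ?_,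
        hR _ heD v (by simp), hR _ heD w (by simp)⟩
      intro hvw
      exact (H.ne_of_adj (hDH _ heD)) (hx hv hw hvw)

open Classical in
/-- A graph with a `1`-subdivision whose branch vertices are all on the side of the choosing
vertices has a large independent set. -/
theorem LayerChoice.exists_isIndepSet_left {n : ℕ → ℕ} {K : ℕ} {f : LayerChoice n K}
    (hf : f.IsSparse) (hdec : ∀ i < K, 10 * n (i + 1) ≤ n i)
    {W : Type*} [Fintype W] (H : SimpleGraph W) (P : Finset W) (x : W → Fin (n 0))
    (y : Sym2 W → LayerVertex n K) (hx : Set.InjOn x P)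
    (hy : Set.InjOn y {e | e ∈ H.edgeSet ∧ ∀ v ∈ e, v ∈ P})
    (hxy : ∀ e ∈ H.edgeSet, (∀ v ∈ e, v ∈ P) → ∀ v ∈ e, f (x v, (y e).1) = (y e).2) :
    ∃ I ⊆ P, H.IsIndepSet (I : Set W) ∧ #P ≤ 18 * #I := by
  rcases P.eq_empty_or_nonempty with rfl | hne
  · exact ⟨∅, by simp, by simp, by simp⟩
  have hPpos : 1 ≤ #P := hne.card_pos
  have hs : #P ≤ 10 * n 0 := by
    have := card_le_card (subset_univ (P.image x))
    rw [card_image_of_injOn hx, card_univ, Fintype.card_fin] at this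
    omega
  obtain ⟨j, hjK, hsj, hjs⟩ := exists_scale K hdec hs
  set D : Finset (Sym2 W) := {e ∈ H.edgeFinset | ∀ v ∈ e, v ∈ P} with hDdef
  have hD : ∀ e ∈ D, e ∈ H.edgeSet ∧ ∀ v ∈ e, v ∈ P := fun e he => by
    simpa [hDdef] using he
  have hyD : Set.InjOn y D := hy.mono fun e he => hD e he
  have hlow : #{e ∈ D | ((y e).1 : ℕ) < j} ≤ 2 * #P := by
    rcases Nat.eq_zero_or_pos j with rfl | hj
    · simp
    obtain ⟨l, rfl⟩ : ∃ l, j = l + 1 := ⟨j - 1, by omega⟩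
    refine card_le_two_mul_of_not_hasDenseIncidence H (f.Rel (l + 1)) P _ x y hx
      (hyD.mono (filter_subset _ _)) (fun e he => (hD e (mem_filter.1 he).1).1)
      (fun e he => (hD e (mem_filter.1 he).1).2) ?_ (hf l (by omega) _ hPpos hsj).1
    intro e he v hv
    have := hD e (mem_filter.1 he).1
    exact ⟨(mem_filter.1 he).2, hxy e this.1 this.2 v hv⟩
  -- Sending an edge to one of its ends is injective here: that end has only one neighbour in layer
  -- `j`, which must be the subdivision vertex.
  have hmid : #{e ∈ D | ((y e).1 : ℕ) = j} ≤ #P := by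
    refine card_le_card_of_injOn (fun e => (Quot.out e).1) ?_ ?_
    · intro e he
      exact (hD e (mem_filter.1 he).1).2 _ (Sym2.out_fst_mem e)
    · intro e he e' he' h
      have hDe := mem_filter.1 he
      have hDe' := mem_filter.1 he'
      refine hyD hDe.1 hDe'.1 ?_
      have h1 := hxy e (hD e hDe.1).1 (hD e hDe.1).2 _ (Sym2.out_fst_mem e)
      have h2 := hxy e' (hD e' hDe'.1).1 (hD e' hDe'.1).2 _ (Sym2.out_fst_mem e')
      have h3 : (y e).1 = (y e').1 := Fin.ext (hDe.2.trans hDe'.2.symm)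
      simp only at h
      rw [← h] at h2
      generalize y e = b at *
      generalize y e' = b' at *
      obtain ⟨i, b⟩ := b
      obtain ⟨i', b'⟩ := b'
      obtain rfl : i = i' := h3
      exact congrArg _ (h1.symm.trans h2)
  have hhigh : #{e ∈ D | j + 1 ≤ ((y e).1 : ℕ)} ≤ ∑ i ∈ Ico (j + 1) K, n i := by
    rw [← card_image_of_injOn (hyD.mono (filter_subset _ _))]
    refine card_filter_layerVertex_le _ fun b hb => ?_
    obtain ⟨e, he, rfl⟩ := mem_image.1 hb
    exact (mem_filter.1 he).2
  have hsplit : #D ≤ #{e ∈ D | ((y e).1 : ℕ) < j} + #{e ∈ D | ((y e).1 : ℕ) = j} +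
      #{e ∈ D | j + 1 ≤ ((y e).1 : ℕ)} := by
    refine (card_le_card ?_).trans
      ((card_union_le _ _).trans (Nat.add_le_add_right (card_union_le _ _) _))
    intro e he
    simp only [mem_union, mem_filter, he, true_and]
    omega
  obtain ⟨I, hIP, hI, hcard⟩ := H.exists_isIndepSet_of_card_edges_le P (by
    have : #D = #{e ∈ H.edgeFinset | ∀ v ∈ e, v ∈ P} := rfl
    omega)
  exact ⟨I, hIP, hI, by omega⟩

open Classical in
/-- A graph with a `1`-subdivision whose branch vertices are all layer vertices has a large
independent set. -/
theorem LayerChoice.exists_isIndepSet_right {n : ℕ → ℕ} {K : ℕ} {f : LayerChoice n K}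
    (hf : f.IsSparse) (hdec : ∀ i < K, 10 * n (i + 1) ≤ n i) (hsum : ∑ i : Fin K, n i ≤ 2 * n 0)
    {W : Type*} [Fintype W] (H : SimpleGraph W) (P : Finset W) (x : W → LayerVertex n K)
    (y : Sym2 W → Fin (n 0)) (hx : Set.InjOn x P)
    (hy : Set.InjOn y {e | e ∈ H.edgeSet ∧ ∀ v ∈ e, v ∈ P})
    (hxy : ∀ e ∈ H.edgeSet, (∀ v ∈ e, v ∈ P) → ∀ v ∈ e, f (y e, (x v).1) = (x v).2) :
    ∃ I ⊆ P, H.IsIndepSet (I : Set W) ∧ #P ≤ 18 * #I := by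
  have hs : #P ≤ 10 * n 0 := by
    have := card_le_card (subset_univ (P.image x))
    rw [card_image_of_injOn hx, card_univ] at this
    have hB : Fintype.card (LayerVertex n K) ≤ 2 * n 0 := by simpa using hsum
    omega
  obtain ⟨j, hjK, hsj, hjs⟩ := exists_scale K hdec hs
  have hsplit : #P ≤ #{v ∈ P | ((x v).1 : ℕ) < j} + #{v ∈ P | ((x v).1 : ℕ) = j} +
      #{v ∈ P | j + 1 ≤ ((x v).1 : ℕ)} := by
    refine (card_le_card ?_).trans
      ((card_union_le _ _).trans (Nat.add_le_add_right (card_union_le _ _) _))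
    intro e he
    simp only [mem_union, mem_filter, he, true_and]
    omega
  have hhigh : #{v ∈ P | j + 1 ≤ ((x v).1 : ℕ)} ≤ ∑ i ∈ Ico (j + 1) K, n i := by
    rw [← card_image_of_injOn (hx.mono (filter_subset _ _))]
    refine card_filter_layerVertex_le _ fun b hb => ?_
    obtain ⟨v, hv, rfl⟩ := mem_image.1 hb
    exact (mem_filter.1 hv).2
  -- Branch vertices in layer `j` are pairwise nonadjacent, as a subdivision vertex has only one
  -- neighbour in that layer.
  by_cases hmid : #P ≤ 18 * #{v ∈ P | ((x v).1 : ℕ) = j}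
  · refine ⟨_, filter_subset _ _, ?_, hmid⟩
    intro v hv w hw hvw hadj
    obtain ⟨hvP, hvj⟩ := mem_filter.1 hv
    obtain ⟨hwP, hwj⟩ := mem_filter.1 hw
    have hP : ∀ u ∈ s(v, w), u ∈ P := by
      intro u hu
      rcases Sym2.mem_iff.1 hu with rfl | rfl <;> assumption
    have h1 := hxy s(v, w) hadj hP v (by simp)
    have h2 := hxy s(v, w) hadj hP w (by simp)
    refine hvw (hx hvP hwP ?_)
    have h3 : (x v).1 = (x w).1 := Fin.ext (hvj.trans hwj.symm)
    generalize x v = b at *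
    generalize x w = b' at *
    obtain ⟨i, b⟩ := b
    obtain ⟨i', b'⟩ := b'
    obtain rfl : i = i' := h3
    exact congrArg _ (h1.symm.trans h2)
  -- Layer `j` now holds less than `1 / 18` of `P` and the later layers at most `1 / 9`, so `Q` has
  -- more than `5 / 6` of `P`; and `5 / 6 * 26 / 324 > 1 / 18`.
  set Q : Finset W := {v ∈ P | ((x v).1 : ℕ) < j} with hQ
  have hQP : Q ⊆ P := filter_subset _ _
  have hQpos : 1 ≤ #Q := by omega
  set D : Finset (Sym2 W) := {e ∈ H.edgeFinset | ∀ v ∈ e, v ∈ Q} with hDdef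
  have hD : ∀ e ∈ D, e ∈ H.edgeSet ∧ ∀ v ∈ e, v ∈ Q := fun e he => by
    simpa [hDdef] using he
  have hDP : (D : Set (Sym2 W)) ⊆ {e | e ∈ H.edgeSet ∧ ∀ v ∈ e, v ∈ P} := fun e he =>
    ⟨(hD e he).1, fun v hv => hQP ((hD e he).2 v hv)⟩
  have hlow : #D ≤ 2 * #Q := by
    obtain ⟨v, hv⟩ := card_pos.1 hQpos
    have hj : 0 < j := (Nat.zero_le _).trans_lt (mem_filter.1 hv).2
    obtain ⟨l, rfl⟩ : ∃ l, j = l + 1 := ⟨j - 1, by omega⟩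
    refine card_le_two_mul_of_not_hasDenseIncidence H (flip (f.Rel (l + 1))) Q D x y
      (hx.mono hQP) (hy.mono hDP)
      (fun e he => (hD e he).1) (fun e he => (hD e he).2) ?_
      (hf l (by omega) _ hQpos ((card_le_card hQP).trans hsj)).2
    intro e he v hv
    exact ⟨(mem_filter.1 ((hD e he).2 v hv)).2,
      hxy e (hD e he).1 (fun v hv => hQP ((hD e he).2 v hv)) v hv⟩
  obtain ⟨I, hIQ, hI, hcard⟩ := H.exists_isIndepSet_of_card_edges_le Q (by
    have : #D = #{e ∈ H.edgeFinset | ∀ v ∈ e, v ∈ Q} := rfl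
    omega)
  exact ⟨I, hIQ.trans hQP, hI, by omega⟩

/-- Graphs whose `1`-subdivision embeds in the graph of a sparse choice have large independent
sets. -/
theorem LayerChoice.card_le_mul_indepNum {n : ℕ → ℕ} {K : ℕ} {f : LayerChoice n K}
    (hf : f.IsSparse) (hpos : ∀ i, 0 < n i) (hK : 0 < K) (hdec : ∀ i < K, 10 * n (i + 1) ≤ n i)
    (hsum : ∑ i : Fin K, n i ≤ 2 * n 0) {W : Type*} [Finite W] (H : SimpleGraph W)
    (h : H.oneSubdivision.IsContained f.graph) : Nat.card W ≤ 18 * H.indepNum := by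
  classical
  have := Fintype.ofFinite W
  obtain ⟨φ, hφ⟩ := h
  let a₀ : Fin (n 0) := ⟨0, hpos 0⟩
  let b₀ : LayerVertex n K := ⟨⟨0, hK⟩, ⟨0, hpos _⟩⟩
  -- `σ` locates subdivision vertices; the defaults `a₀` and `b₀` only make the maps total.
  let σ : Sym2 W → Fin (n 0) ⊕ LayerVertex n K := fun e =>
    if he : e ∈ H.edgeSet then φ (Sum.inr ⟨e, he⟩) else Sum.inl a₀
  have hσ : Set.InjOn σ H.edgeSet := by
    intro e he e' he' h
    simp only [σ, dif_pos he, dif_pos he'] at h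
    simpa using hφ h
  have hadj : ∀ e ∈ H.edgeSet, ∀ v ∈ e, f.graph.Adj (φ (Sum.inl v)) (σ e) := by
    intro e he v hv
    simp only [σ, dif_pos he]
    exact φ.map_rel (show H.oneSubdivision.Adj (Sum.inl v) (Sum.inr ⟨e, he⟩) from hv)
  let P : Finset W := {v | (φ (Sum.inl v)).isLeft}
  let Q : Finset W := {v | (φ (Sum.inl v)).isRight}
  have hP : ∀ v ∈ P, ∃ a, φ (Sum.inl v) = Sum.inl a := fun v hv =>
    Sum.isLeft_iff.1 (mem_filter.1 hv).2
  have hQ : ∀ v ∈ Q, ∃ b, φ (Sum.inl v) = Sum.inr b := fun v hv =>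
    Sum.isRight_iff.1 (mem_filter.1 hv).2
  have hPe : ∀ e ∈ H.edgeSet, (∀ v ∈ e, v ∈ P) → ∃ b, σ e = Sum.inr b := by
    intro e he hv
    have hmem := Sym2.out_fst_mem e
    obtain ⟨a, ha⟩ := hP _ (hv _ hmem)
    have := hadj e he _ hmem
    rw [ha] at this
    cases hσe : σ e with
    | inl a' => rw [hσe] at this; exact this.elim
    | inr b => exact ⟨b, rfl⟩
  have hQe : ∀ e ∈ H.edgeSet, (∀ v ∈ e, v ∈ Q) → ∃ a, σ e = Sum.inl a := by
    intro e he hv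
    have hmem := Sym2.out_fst_mem e
    obtain ⟨b, hb⟩ := hQ _ (hv _ hmem)
    have := hadj e he _ hmem
    rw [hb] at this
    cases hσe : σ e with
    | inl a => exact ⟨a, rfl⟩
    | inr b' => rw [hσe] at this; exact this.elim
  obtain ⟨I, hIP, hI, hIcard⟩ := LayerChoice.exists_isIndepSet_left hf hdec H P
    (fun v => (φ (Sum.inl v)).elim id fun _ => a₀) (fun e => (σ e).elim (fun _ => b₀) id)
    (by
      intro v hv w hw h
      obtain ⟨a, ha⟩ := hP v hv
      obtain ⟨a', ha'⟩ := hP w hw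
      simp only [ha, ha', Sum.elim_inl, id] at h
      exact Sum.inl_injective (hφ (ha.trans ((congrArg _ h).trans ha'.symm))))
    (by
      rintro e ⟨he, hev⟩ e' ⟨he', hev'⟩ h
      obtain ⟨b, hb⟩ := hPe e he hev
      obtain ⟨b', hb'⟩ := hPe e' he' hev'
      simp only [hb, hb', Sum.elim_inr, id] at h
      exact hσ he he' (hb.trans ((congrArg _ h).trans hb'.symm)))
    (by
      intro e he hev v hv
      obtain ⟨a, ha⟩ := hP v (hev v hv)
      obtain ⟨b, hb⟩ := hPe e he hev
      have := hadj e he v hv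
      rw [ha, hb] at this
      have hx : (φ (Sum.inl v)).elim id (fun _ => a₀) = a := by rw [ha]; rfl
      have hy : (σ e).elim (fun _ => b₀) id = b := by rw [hb]; rfl
      rw [hx, hy]
      exact this)
  obtain ⟨J, hJQ, hJ, hJcard⟩ := LayerChoice.exists_isIndepSet_right hf hdec hsum H Q
    (fun v => (φ (Sum.inl v)).elim (fun _ => b₀) id) (fun e => (σ e).elim id fun _ => a₀)
    (by
      intro v hv w hw h
      obtain ⟨b, hb⟩ := hQ v hv
      obtain ⟨b', hb'⟩ := hQ w hw
      simp only [hb, hb', Sum.elim_inr, id] at h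
      exact Sum.inl_injective (hφ (hb.trans ((congrArg _ h).trans hb'.symm))))
    (by
      rintro e ⟨he, hev⟩ e' ⟨he', hev'⟩ h
      obtain ⟨a, ha⟩ := hQe e he hev
      obtain ⟨a', ha'⟩ := hQe e' he' hev'
      simp only [ha, ha', Sum.elim_inl, id] at h
      exact hσ he he' (ha.trans ((congrArg _ h).trans ha'.symm)))
    (by
      intro e he hev v hv
      obtain ⟨b, hb⟩ := hQ v (hev v hv)
      obtain ⟨a, ha⟩ := hQe e he hev
      have := hadj e he v hv
      rw [ha, hb] at this
      have hx : (φ (Sum.inl v)).elim (fun _ => b₀) id = b := by rw [hb]; rfl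
      have hy : (σ e).elim id (fun _ => a₀) = a := by rw [ha]; rfl
      rw [hx, hy]
      exact this)
  -- The subdivision vertex of such an edge would have neighbours on both sides of the bipartition.
  have hcross : ∀ v ∈ I, ∀ w ∈ J, ¬ H.Adj v w := by
    intro v hv w hw hvw
    obtain ⟨a, ha⟩ := hP v (hIP hv)
    obtain ⟨b, hb⟩ := hQ w (hJQ hw)
    have h1 := hadj s(v, w) hvw v (by simp)
    have h2 := hadj s(v, w) hvw w (by simp)
    rw [ha] at h1
    rw [hb] at h2
    cases hσe : σ s(v, w) with
    | inl a' => rw [hσe] at h1; exact h1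
    | inr b' => rw [hσe] at h2; exact h2
  have hunion : H.IsIndepSet ((I ∪ J : Finset W) : Set W) := by
    intro v hv w hw hvw
    rcases mem_union.1 hv with hv | hv <;> rcases mem_union.1 hw with hw | hw
    · exact hI hv hw hvw
    · exact hcross v hv w hw
    · exact fun h => hcross w hw v hv h.symm
    · exact hJ hv hw hvw
  have hPQ : Disjoint P Q := by
    rw [Finset.disjoint_left]
    intro v hv hv'
    obtain ⟨a, ha⟩ := hP v hv
    obtain ⟨b, hb⟩ := hQ v hv'
    rw [ha] at hb
    exact absurd hb (by simp)
  have hle := hunion.card_le_indepNum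
  rw [card_union_of_disjoint (hPQ.mono hIP hJQ)] at hle
  have hW : Fintype.card W ≤ #P + #Q := by
    rw [← card_univ, ← card_union_of_disjoint hPQ]
    refine card_le_card fun v _ => ?_
    simp only [P, Q, mem_union, mem_filter, mem_univ, true_and]
    cases φ (Sum.inl v) <;> simp
  rw [Nat.card_eq_fintype_card]
  omega

/-! ### Passage to the Hall ratio and conclusion -/

namespace SimpleGraph

theorem oneSubdivision_isContained {V W : Type*} {G : SimpleGraph V} {H : SimpleGraph W}
    (φ : G →g H) (hφ : Function.Injective φ) :
    G.oneSubdivision.IsContained H.oneSubdivision := by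
  refine ⟨⟨⟨Sum.map φ φ.mapEdgeSet, ?_⟩, hφ.sumMap (Hom.mapEdgeSet.injective φ hφ)⟩⟩
  rintro (v | e) (w | e') h
  · exact h.elim
  · exact Sym2.mem_map.2 ⟨v, h, rfl⟩
  · exact Sym2.mem_map.2 ⟨w, h, rfl⟩
  · exact h.elim

/-- If the vertex count of every graph whose `1`-subdivision is contained in `G` is at most `c`
times its independence number, then all these graphs have Hall ratio at most `c`. -/
theorem hallRatio_le_of_forall_card_le {V : Type*} {W : Type*} [Finite W] {G : SimpleGraph V}
    {H : SimpleGraph W} (c : ℕ)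
    (hG : ∀ K : H.Subgraph, K.coe.oneSubdivision.IsContained G →
      Nat.card K.verts ≤ c * K.coe.indepNum)
    (h : H.oneSubdivision.IsContained G) : H.hallRatio ≤ c := by
  obtain ⟨K, hK⟩ := (hallRatio_isGreatest H).1
  rw [← hK]
  have hcard := hG K ((oneSubdivision_isContained K.hom Subgraph.hom_injective).trans h)
  refine div_le_of_le_mul₀ (Nat.cast_nonneg _) (Nat.cast_nonneg _) ?_
  exact_mod_cast hcard

end SimpleGraph

theorem theorem2 (d : ℕ) (hd : 1 ≤ d) :
    ∃ (V : Type) (_ : Fintype V) (G : SimpleGraph V) (_ : DecidableRel G.Adj),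
      G.IsBipartite ∧ (d : ℝ) ≤ G.averageDegree ∧
        ∀ (W : Type*) [Finite W] (H : SimpleGraph W),
          18 < H.hallRatio → ¬ H.oneSubdivision.IsContained G := by
  classical
  -- The average degree is only guaranteed to be `K / 3`.
  set K := 3 * d with hK
  set c := 4320 * K with hc
  have hc0 : 10 ≤ c := by omega
  set n := layerSize c K with hn
  have hpos : ∀ i, 0 < n i := layerSize_pos (by omega) K
  have hdec : ∀ i < K, 10 * n (i + 1) ≤ n i := fun i hi =>
    (Nat.mul_le_mul_right _ hc0).trans (mul_layerSize_succ_le (by omega) K i hi)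
  have hsum : ∑ i : Fin K, n i ≤ 2 * n 0 := by
    have := nine_mul_sum_Ico_le (Nat.zero_le K) hdec
    rw [Fin.sum_univ_eq_sum_range n K, Finset.range_eq_Ico]
    omega
  obtain ⟨f, hf⟩ := LayerChoice.exists_isSparse (K := K) hpos (layerSize_antitone (by omega) K)
    (fun i hi => (mul_layerSize_succ_mul_pow c K i hi).le) hsum
  refine ⟨_, inferInstance, f.graph, inferInstance, f.isBipartite_graph, ?_, ?_⟩
  · refine le_trans ?_ (f.le_averageDegree_graph (hpos 0) hsum)
    rw [hK]
    push_cast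
    linarith
  · intro W _ H hH h
    refine absurd (SimpleGraph.hallRatio_le_of_forall_card_le 18 (fun L hL => ?_) h)
      (by push_cast; exact not_le.2 hH)
    exact LayerChoice.card_le_mul_indepNum hf hpos (by omega) hdec hsum L.coe hL
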